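/- A multi-player mean-payoff game arena consists of a finite set $P$ of players with a distinguished leader $l\in P$ (the other players are the followers), a finite set $V$ of vertices with an initial vertex $v_0$, a partition $(V_p)_{p\in P}$ of $V$ (a player $p$ owns the vertices in $V_p$), a set $E\subseteq V\times V$ of edges such that every vertex has a successor, and reward functions $r_p:E\to\mathbb Q$. A history is a finite play, i.e. a finite path from $v_0$. A strategy of $p$ is a map $\sigma_p:V^*V_p\to V$ that always selects a successor of the last vertex. A strategy profile $\sigma=(\sigma_p)_{p\in P}$ defines a unique infinite play $\pi_\sigma$ from $v_0$. An incentive profile $\gamma$ assigns to every follower $p$ a function $\gamma_p$ from histories to $\mathbb R_{\ge 0}$. On an infinite play $\pi=v_0v_1v_2\dots$ let $$r_p(\pi)=\liminf_{n\to\infty}\frac1n\sum_{i=0}^{n-1}r_p(v_i,v_{i+1}),\qquad \gamma_p(\pi)=\liminf_{n\to\infty}\frac1n\sum_{i=0}^{n-1}\gamma_p(v_0\dots v_i)\in[0,\infty].$$ The overall payoff is $r_p(\pi)+\gamma_p(\pi)$ for a follower $p$ and $r_l(\pi)-\sum_{p\ne l}\gamma_p(\pi)$ for the leader. The pair $(\sigma,\gamma)$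 is an incentive strategy profile (ISP) if no follower can increase his overall payoff by a unilateral change of his strategy (with $\gamma$ unchanged). For a player $p$, let $\mathcal G_p$ be the two-player mean-payoff game in which $p$, with reward function $r_p$, plays against the coalition of all other players, with reward function $-r_p$. A history is deviating if it is not a prefix of $\pi_\sigma$; the last deviator on a deviating history $u_0\dots u_n$ is the owner of $u_i$ for the largest $i<n$ such that $u_{i+1}$ is not the vertex selected by $\sigma$ after $u_0\dots u_i$. Let $r_{\max}$ be the largest reward of any player on any edge. The pair $(\sigma,\gamma)$ is a perfectly-incentivised strategy profile (PSP) if 1. for every follower $p$, $\gamma_p$ is constant on the (non-empty) prefixes of $\pi_\sigma$; 2. there are, for each player $p$, optimal memoryless strategies for both sides of $\mathcal G_p$ such that, on every deviating history $h$ with last deviator $p$, the owner of the last vertex of $h$ (who may be $p$ himself) moves according to these strategies; 3. whenever $h$ is a deviating history with last deviator $p$ and last vertex $v$, the owner $p'$ of $v$ is a follower with $p'\neq p$, and $v'$ is the successor selected by $\sigma$ after $h$, then $r_{p'}(v,v')+\gamma_{p'}(h\cdot v')=r_{\max}+1$; 4. all incentives on deviating histories that are not determined by 3 are $0$. **Theorem.**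 Let $(\sigma,\gamma)$ be an ISP such that $\gamma_p(\pi_\sigma)<\infty$ for every follower $p$. Then there is a PSP $(\sigma',\gamma')$ that is also an ISP, defines the same play, $\pi_{\sigma'}=\pi_\sigma$, and gives the same overall payoff as $(\sigma,\gamma)$ to the leader and to every follower. -/

import Mathlib

open scoped NNReal

/-- A multi-player mean-payoff game arena with players `P` and vertices `V`. The partition
`(V_p)` is given by the owner of each vertex. Only the values of `reward p` on edges are ever
used. -/
structure MMPGArena (P V : Type*) where
  leader : P
  init : V
  owner : V → P
  Edge : V → V → Prop
  exists_edge : ∀ v, ∃ u, Edge v u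
  reward : P → V → V → ℚ

/-- The limit average `liminf_n (1/n) ∑_{i < n} c i`, as an extended real number. -/
noncomputable def meanPayoff (c : ℕ → ℝ) : EReal :=
  Filter.liminf (fun n : ℕ => (((∑ i ∈ Finset.range n, c i) / n : ℝ) : EReal)) Filter.atTop

/-- The first `n` vertices `x 0, …, x (n - 1)` of a play. -/
def playPast {V : Type*} (x : ℕ → V) (n : ℕ) : List V :=
  (List.range n).map x

namespace MMPGArena

variable {P V : Type*} (A : MMPGArena P V)

/-- The players other than the leader. -/
abbrev Follower : Type _ := {p : P // p ≠ A.leader}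

/-- A pair `w : List V`, `v : V` stands for the history `w · v` with last vertex `v`.
A strategy of `p` is a map `V^* V_p → V` that always selects a successor of the last vertex. -/
abbrev Strategy (p : P) : Type _ :=
  List V → (v : {v : V // A.owner v = p}) → {u : V // A.Edge v u}

/-- A strategy profile: one strategy for every player. -/
abbrev Profile : Type _ := (p : P) → A.Strategy p

/-- An incentive profile: for every follower and every history a non-negative real. -/
abbrev IncentiveProfile : Type _ := A.Follower → List V → V → ℝ≥0

variable {A} in
/-- The vertex selected by a profile after the history `w · v`, chosen by the owner of `v`. -/
def Profile.move (σ : A.Profile) (w : List V) (v : V) : V :=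
  (σ (A.owner v) w ⟨v, rfl⟩ : V)

variable {A} in
/-- The history (past, current vertex) after `n` moves of the profile, started in `v`. -/
def Profile.historyFrom (σ : A.Profile) (v : V) : ℕ → List V × V
  | 0 => ([], v)
  | n + 1 =>
    ((σ.historyFrom v n).1 ++ [(σ.historyFrom v n).2],
      σ.move (σ.historyFrom v n).1 (σ.historyFrom v n).2)

variable {A} in
/-- The infinite play defined by a profile when started in `v`. -/
def Profile.playFrom (σ : A.Profile) (v : V) (n : ℕ) : V := (σ.historyFrom v n).2

variable {A} in
/-- The play `π_σ` defined by a profile. -/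
def Profile.play (σ : A.Profile) : ℕ → V := σ.playFrom A.init

/-- The raw payoff of player `p` on an infinite play. -/
noncomputable def rawPayoff (p : P) (x : ℕ → V) : EReal :=
  meanPayoff fun i => (A.reward p (x i) (x (i + 1)) : ℝ)

/-- The limit average of the incentives that follower `p` receives on an infinite play. -/
noncomputable def incentivePayoff (γ : A.IncentiveProfile) (p : A.Follower) (x : ℕ → V) : EReal :=
  meanPayoff fun i => (γ p (playPast x i) (x i) : ℝ)

/-- The overall payoff of a follower: raw payoff plus incentives. -/
noncomputable def followerPayoff (γ : A.IncentiveProfile) (p : A.Follower) (x : ℕ → V) : EReal :=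
  A.rawPayoff p x + A.incentivePayoff γ p x

/-- The overall payoff of the leader: raw payoff minus all incentives paid. -/
noncomputable def leaderPayoff [Fintype P] [DecidableEq P] (γ : A.IncentiveProfile)
    (x : ℕ → V) : EReal :=
  A.rawPayoff A.leader x - ∑ p : {p : P // p ≠ A.leader}, A.incentivePayoff γ p x

/-- Incentive strategy profile: no follower improves his overall payoff by a unilateral
deviation. -/
def IsISP [DecidableEq P] (σ : A.Profile) (γ : A.IncentiveProfile) : Prop :=
  ∀ (p : A.Follower) (τ : A.Strategy p),
    A.followerPayoff γ p (Profile.play (Function.update σ (p : P) τ))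
      ≤ A.followerPayoff γ p σ.play

/-- The value at `v` of the two-player mean-payoff game in which `p`, with his own rewards, plays
against the coalition of all other players, who have the rewards `-r_p`. -/
noncomputable def value [DecidableEq P] (p : P) (v : V) : EReal :=
  ⨆ τ : A.Strategy p, ⨅ σ : A.Profile,
    A.rawPayoff p (Profile.playFrom (Function.update σ p τ) v)

/-- An infinite path of the arena, starting anywhere. -/
def IsPath (x : ℕ → V) : Prop := ∀ n, A.Edge (x n) (x (n + 1))

/-- `f` is a pair of optimal memoryless strategies in the two-player game of `p` against all
others: on the vertices of `p` it guarantees `p` the value of the vertex where the game starts, and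
on all other vertices it guarantees the coalition, whose rewards are `-r_p`, minus this value. -/
def IsOptimalMemoryless [DecidableEq P] (p : P) (f : V → V) : Prop :=
  (∀ v, A.Edge v (f v)) ∧
  (∀ x, A.IsPath x → (∀ n, A.owner (x n) = p → x (n + 1) = f (x n)) →
    A.value p (x 0) ≤ A.rawPayoff p x) ∧
  (∀ x, A.IsPath x → (∀ n, A.owner (x n) ≠ p → x (n + 1) = f (x n)) →
    -A.value p (x 0) ≤ meanPayoff fun i => -(A.reward p (x i) (x (i + 1)) : ℝ))

/-- `w · v` is a finite play: it starts in the initial vertex and follows edges. -/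
inductive IsFinitePlay : List V → V → Prop
  | init : IsFinitePlay [] A.init
  | step {w : List V} {v u : V} :
      IsFinitePlay w v → A.Edge v u → IsFinitePlay (w ++ [v]) u

/-- `w · v` is a deviating history: a finite play that is not a prefix of `π_σ`. -/
def IsDeviating (σ : A.Profile) (w : List V) (v : V) : Prop :=
  A.IsFinitePlay w v ∧ ¬ ∃ n, w = playPast σ.play n ∧ v = σ.play n

/-- `LastDeviator σ w v p`: on the deviating history `w · v`, the player `p` is the last one who
has deviated from his strategy in `σ`. -/
inductive LastDeviator (σ : A.Profile) : List V → V → P → Prop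
  | now {w : List V} {v u : V} :
      A.IsFinitePlay w v → A.Edge v u → u ≠ σ.move w v →
      LastDeviator σ (w ++ [v]) u (A.owner v)
  | later {w : List V} {v : V} {p : P} :
      LastDeviator σ w v p → LastDeviator σ (w ++ [v]) (σ.move w v) p

/-- The largest reward of any player on any edge. -/
noncomputable def rMax : ℝ :=
  sSup {r : ℝ | ∃ p u v, A.Edge u v ∧ r = (A.reward p u v : ℝ)}

/-- The history `w · v` is of the form `h · v` where `h` is a deviating history, `q` owns the last
vertex of `h`, `q` is not the last deviator on `h`, and `v` is the successor that `q` selects. -/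
def IsPunishingMove (σ : A.Profile) (q : A.Follower) (w : List V) (v : V) : Prop :=
  ∃ (w' : List V) (v' : V) (p : P), A.LastDeviator σ w' v' p ∧ A.owner v' = q ∧ (q : P) ≠ p ∧
    w = w' ++ [v'] ∧ v = σ.move w' v'

/-- Perfectly-incentivised strategy profile. -/
structure IsPSP [DecidableEq P] (σ : A.Profile) (γ : A.IncentiveProfile) : Prop where
  /-- Incentives are constant on the prefixes of `π_σ`. -/
  const_on_play : ∀ (p : A.Follower) (m n : ℕ),
    γ p (playPast σ.play m) (σ.play m) = γ p (playPast σ.play n) (σ.play n)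
  /-- After a deviation, everybody follows fixed optimal memoryless strategies of the two-player
  game of the last deviator against all others. -/
  punish : ∃ f : P → V → V, (∀ p, A.IsOptimalMemoryless p (f p)) ∧
    ∀ w v p, A.LastDeviator σ w v p → σ.move w v = f p v
  /-- A follower who takes part in the punishment of another player has his reward for this move
  topped up to `r_max + 1`. -/
  reward_punisher : ∀ (q : A.Follower) (w : List V) (v : V) (p : P), A.LastDeviator σ w v p →
    A.owner v = q → (q : P) ≠ p →
    (A.reward q v (σ.move w v) : ℝ) + γ q (w ++ [v]) (σ.move w v) = A.rMax + 1
  /-- All other incentives on deviating histories are zero. -/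
  zero_otherwise : ∀ (q : A.Follower) (w : List V) (v : V), A.IsDeviating σ w v →
    ¬ A.IsPunishingMove σ q w v → γ q w v = 0

end MMPGArena

/-! ### Limit averages -/

section MeanPayoff

/-! Keep the play, replace each follower's incentives on it by the constant equal to his old limit
average, and punish the last deviator `p` with optimal memoryless play against him. All payoffs on
the play are unchanged. For stability, suppose `p` first leaves the play by moving to `u`. In the
new profile he remains the last deviator forever. He thus receives no further incentives, and the
coalition holds his raw payoff to at most `g p u`, the value of his game at `u` (`exists_deviation`,
`isISP_punishProfile`). In the old profile he could have made the same move and then played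
optimally. Incentives are non-negative, so this would have earned him at least `g p u`; hence `g p
u` is at most his equilibrium payoff (`IsISP.le_followerPayoff`). Both bounds rest on memoryless
determinacy (`exists_memoryless_meanPayoff`), obtained from discounted games as the discount factor
vanishes. -/

theorem meanPayoff_nonneg {c : ℕ → ℝ} (hc : ∀ i, 0 ≤ c i) : 0 ≤ meanPayoff c := by
  refine Filter.le_liminf_of_le (by isBoundedDefault) (Filter.Eventually.of_forall fun n => ?_)
  exact_mod_cast div_nonneg (Finset.sum_nonneg fun i _ => hc i) (Nat.cast_nonneg n)

theorem meanPayoff_const (a : ℝ) : meanPayoff (fun _ => a) = a := by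
  refine (tendsto_const_nhds.congr' ?_).liminf_eq
  filter_upwards [Filter.eventually_gt_atTop 0] with n hn
  have : (n : ℝ) ≠ 0 := by positivity
  simp [mul_div_cancel_left₀ _ this]

theorem meanPayoff_eq_zero_of_eventually_zero {c : ℕ → ℝ} {m : ℕ} (hc : ∀ i, m ≤ i → c i = 0) :
    meanPayoff c = 0 := by
  have h : Filter.Tendsto (fun n : ℕ => (∑ i ∈ Finset.range n, c i) / (n : ℝ)) Filter.atTop
      (nhds 0) := by
    refine (tendsto_const_div_atTop_nhds_zero_nat (∑ i ∈ Finset.range m, c i)).congr' ?_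
    filter_upwards [Filter.eventually_ge_atTop m] with n hn
    congr 1
    refine Finset.sum_subset (Finset.range_mono hn) fun i _ hi => hc i ?_
    simpa using hi
  exact ((continuous_coe_real_ereal.tendsto 0).comp h).liminf_eq

/-- Negation turns the limit inferior into minus the limit superior, so the coalition's guarantee
bounds even the limit superior of the averages. -/
theorem meanPayoff_le_of_neg_le {c : ℕ → ℝ} {a : ℝ}
    (h : -(a : EReal) ≤ meanPayoff fun i => -c i) : meanPayoff c ≤ a := by
  have e : (meanPayoff fun i => -c i) = -Filter.limsup
      (fun n : ℕ => (((∑ i ∈ Finset.range n, c i) / n : ℝ) : EReal)) Filter.atTop := by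
    rw [← EReal.liminf_neg]
    unfold meanPayoff
    congr 1
    ext n
    simp [Finset.sum_neg_distrib, neg_div]
  rw [e, EReal.neg_le_neg_iff] at h
  exact (Filter.liminf_le_limsup (by isBoundedDefault) (by isBoundedDefault)).trans h

/-- If, for discount factors tending to `0`, the potentials `v k` satisfy the discounted Bellman
inequality along a path from time `m` on, then their limit at time `m` bounds the mean payoff. -/
theorem le_meanPayoff_of_bellman {V ι : Type*} [Finite V] {F : Filter ι} [F.NeBot] {lam : ι → ℝ}
    {v : ι → V → ℝ} {g : V → ℝ} (hlam : ∀ k, 0 < lam k ∧ lam k ≤ 1)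
    (hlim : Filter.Tendsto lam F (nhds 0)) (hv : Filter.Tendsto v F (nhds g))
    {c : ℕ → ℝ} {x : ℕ → V} {m : ℕ}
    (hb : ∀ᶠ k in F, ∀ n, m ≤ n →
      v k (x n) ≤ lam k * c n + (1 - lam k) * v k (x (n + 1))) :
    (g (x m) : EReal) ≤ meanPayoff c := by
  have hvx : ∀ y, Filter.Tendsto (fun k => v k y) F (nhds (g y)) := tendsto_pi_nhds.1 hv
  -- In the limit the Bellman inequality loses its reward term, so `g` cannot decrease along the
  -- path.
  have hmono : ∀ n, m ≤ n → g (x n) ≤ g (x (n + 1)) := fun n hn => by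
    have h1 : Filter.Tendsto (fun k => lam k * c n + (1 - lam k) * v k (x (n + 1))) F
        (nhds (0 * c n + (1 - 0) * g (x (n + 1)))) :=
      (hlim.mul_const _).add ((hlim.const_sub 1).mul (hvx _))
    have := le_of_tendsto_of_tendsto (hvx (x n)) h1 (hb.mono fun k hk => hk n hn)
    linarith
  have hge : ∀ n, g (x m) ≤ g (x (m + n)) := fun n => by
    induction n with
    | zero => simp
    | succ n ih => exact ih.trans (hmono (m + n) (by omega))
  refine EReal.ge_of_forall_gt_iff_ge.1 fun a ha => ?_
  have ha' : a < g (x m) := by exact_mod_cast ha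
  -- The midpoint leaves the slack `b - a`, which will absorb all bounded terms.
  set b := (a + g (x m)) / 2 with hbdef
  have hclose : ∀ᶠ k in F, ∀ y, g y - (g (x m) - b) ≤ v k y := by
    refine Filter.eventually_all.2 fun y => ?_
    exact ((hvx y).eventually_const_le (by linarith))
  -- A single discount factor suffices from here on.
  obtain ⟨k, hk, hk'⟩ := (hb.and hclose).exists
  obtain ⟨h0, h1⟩ := hlam k
  obtain ⟨C, hC⟩ := (Set.finite_range (v k)).bddAbove
  have hC' : ∀ y, v k y ≤ C := fun y => hC ⟨y, rfl⟩
  set S : ℕ → ℝ := fun n => ∑ i ∈ Finset.range n, c i with hS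
  -- The Bellman inequality reads `lam * c ≥ lam * v + (1 - lam) * (v - v')`. The last term
  -- telescopes, and `v ≥ b` along the path.
  have key : ∀ n : ℕ, lam k * S m + n * (lam k * b) + (1 - lam k) * (v k (x m) - v k (x (m + n)))
      ≤ lam k * S (m + n) := fun n => by
    induction n with
    | zero => simp
    | succ n ih =>
      have e1 : S (m + (n + 1)) = S (m + n) + c (m + n) := Finset.sum_range_succ _ _
      have e2 := hk (m + n) (by omega)
      have e3 : b ≤ v k (x (m + n)) := by linarith [hk' (x (m + n)), hge n]
      have e4 := mul_le_mul_of_nonneg_left e3 h0.le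
      rw [e1, ← add_assoc m n 1]
      push_cast
      nlinarith
  set K : ℝ := lam k * S m + (1 - lam k) * (v k (x m) - C) - m * (lam k * b) with hK
  have key2 : ∀ n : ℕ, m ≤ n → K + n * (lam k * b) ≤ lam k * S n := fun n hn => by
    obtain ⟨j, rfl⟩ := Nat.exists_eq_add_of_le hn
    have e5 := mul_le_mul_of_nonneg_left (hC' (x (m + j))) (sub_nonneg.2 h1)
    have := key j
    push_cast
    nlinarith
  have hab : 0 < lam k * (b - a) := mul_pos h0 (by rw [hbdef]; linarith)
  obtain ⟨N, hN⟩ := exists_nat_ge (-K / (lam k * (b - a)))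
  refine Filter.le_liminf_of_le (by isBoundedDefault) ?_
  filter_upwards [Filter.eventually_ge_atTop m, Filter.eventually_ge_atTop N,
    Filter.eventually_gt_atTop 0] with n hm hn hpos
  have hnpos : (0 : ℝ) < n := by exact_mod_cast hpos
  rw [EReal.coe_le_coe_iff, le_div_iff₀ hnpos]
  have h2 : -K ≤ n * (lam k * (b - a)) := by
    rw [← div_le_iff₀ hab]
    exact hN.trans (by exact_mod_cast hn)
  have h3 := key2 n hm
  refine le_of_mul_le_mul_left ?_ h0
  change lam k * (a * n) ≤ lam k * S n
  nlinarith

end MeanPayoff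

/-! ### Memoryless determinacy via discounted games -/

section Determinacy

variable {V : Type*}

theorem abs_sup'_sub_sup'_le {s : Finset V} (hs : s.Nonempty) {a b : V → ℝ} {K : ℝ}
    (h : ∀ y, |a y - b y| ≤ K) : |s.sup' hs a - s.sup' hs b| ≤ K := by
  have aux : ∀ a b : V → ℝ, (∀ y, |a y - b y| ≤ K) → s.sup' hs a ≤ s.sup' hs b + K := by
    intro a b h
    refine Finset.sup'_le _ _ fun y hy => ?_
    linarith [(abs_le.1 (h y)).2, Finset.le_sup' b hy]
  rw [abs_le]
  constructor
  · linarith [aux b a fun y => abs_sub_comm (a y) (b y) ▸ h y]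
  · linarith [aux a b h]

theorem abs_inf'_sub_inf'_le {s : Finset V} (hs : s.Nonempty) {a b : V → ℝ} {K : ℝ}
    (h : ∀ y, |a y - b y| ≤ K) : |s.inf' hs a - s.inf' hs b| ≤ K := by
  have aux : ∀ a b : V → ℝ, (∀ y, |a y - b y| ≤ K) → s.inf' hs a - K ≤ s.inf' hs b := by
    intro a b h
    refine Finset.le_inf' _ _ fun y hy => ?_
    linarith [(abs_le.1 (h y)).2, Finset.inf'_le a hy]
  rw [abs_le]
  constructor
  · linarith [aux b a fun y => abs_sub_comm (a y) (b y) ▸ h y]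
  · linarith [aux a b h]

/-- Value and optimal memoryless strategies of a two-player discounted game: the vertices in `M`
belong to the maximizer. -/
theorem exists_discounted_solution [Finite V] {E : V → V → Prop} (hE : ∀ v, ∃ u, E v u)
    (M : V → Prop) {w : V → V → ℝ} {B : ℝ} (hB : ∀ x y, |w x y| ≤ B) {lam : ℝ} (h0 : 0 < lam)
    (h1 : lam ≤ 1) :
    ∃ (v : V → ℝ) (f : V → V), (∀ x, E x (f x)) ∧ (∀ x, |v x| ≤ B) ∧
      (∀ x, v x = lam * w x (f x) + (1 - lam) * v (f x)) ∧
      (∀ x y, M x → E x y → lam * w x y + (1 - lam) * v y ≤ v x) ∧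
      (∀ x y, ¬ M x → E x y → v x ≤ lam * w x y + (1 - lam) * v y) := by
  classical
  have := Fintype.ofFinite V
  let s : V → Finset V := fun x => Finset.univ.filter (E x)
  have hs : ∀ x, (s x).Nonempty := fun x => (hE x).imp fun y hy => by simpa [s] using hy
  have mem_s : ∀ {x y}, y ∈ s x ↔ E x y := by simp [s]
  let q : (V → ℝ) → V → V → ℝ := fun v x y => lam * w x y + (1 - lam) * v y
  -- The Shapley operator; it contracts the sup norm by `1 - lam`, and its fixed point is the
  -- discounted value.
  let T : (V → ℝ) → V → ℝ := fun v x =>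
    if M x then (s x).sup' (hs x) (q v x) else (s x).inf' (hs x) (q v x)
  have hT : ContractingWith (Real.toNNReal (1 - lam)) T := by
    refine ⟨Real.toNNReal_lt_one.2 (by linarith), LipschitzWith.of_dist_le_mul fun u v => ?_⟩
    have hnn : 0 ≤ (1 - lam) * dist u v := mul_nonneg (by linarith) dist_nonneg
    rw [Real.coe_toNNReal _ (by linarith)]
    refine (dist_pi_le_iff hnn).2 fun x => ?_
    have hq : ∀ y, |q u x y - q v x y| ≤ (1 - lam) * dist u v := fun y => by
      have : q u x y - q v x y = (1 - lam) * (u y - v y) := by simp only [q]; ring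
      rw [this, abs_mul, abs_of_nonneg (by linarith : 0 ≤ 1 - lam), ← Real.dist_eq]
      exact mul_le_mul_of_nonneg_left (dist_le_pi_dist u v y) (by linarith)
    rw [Real.dist_eq]
    by_cases hM : M x
    · simpa only [T, if_pos hM] using abs_sup'_sub_sup'_le (hs x) hq
    · simpa only [T, if_neg hM] using abs_inf'_sub_inf'_le (hs x) hq
  let v := hT.fixedPoint
  have hv : T v = v := hT.fixedPoint_isFixedPt
  have hf : ∀ x, ∃ y, E x y ∧ v x = q v x y := fun x => by
    rw [← congrFun hv x]
    by_cases hM : M x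
    · obtain ⟨y, hy, e⟩ := Finset.exists_mem_eq_sup' (hs x) (q v x)
      exact ⟨y, mem_s.1 hy, by simp only [T, if_pos hM]; exact e⟩
    · obtain ⟨y, hy, e⟩ := Finset.exists_mem_eq_inf' (hs x) (q v x)
      exact ⟨y, mem_s.1 hy, by simp only [T, if_neg hM]; exact e⟩
  choose f hfE hfv using hf
  refine ⟨v, f, hfE, fun x => ?_, hfv, fun x y hM hy => ?_, fun x y hM hy => ?_⟩
  · have : Nonempty V := ⟨x⟩
    -- At a maximum of `|v|` the equation gives `|v z| ≤ lam * B + (1 - lam) * |v z|`.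
    obtain ⟨z, hz⟩ := Finite.exists_max fun x => |v x|
    refine (hz x).trans (le_of_mul_le_mul_left ?_ h0)
    have e1 : |v z| ≤ lam * |w z (f z)| + (1 - lam) * |v (f z)| := by
      conv_lhs => rw [hfv z]
      refine (abs_add_le _ _).trans_eq ?_
      rw [abs_mul, abs_mul, abs_of_pos h0, abs_of_nonneg (by linarith : 0 ≤ 1 - lam)]
    have e2 := mul_le_mul_of_nonneg_left (hB z (f z)) h0.le
    have e3 := mul_le_mul_of_nonneg_left (hz (f z)) (by linarith : 0 ≤ 1 - lam)
    linarith
  · rw [← congrFun hv x]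
    simp only [T, if_pos hM]
    exact Finset.le_sup' (q v x) (mem_s.2 hy)
  · rw [← congrFun hv x]
    simp only [T, if_neg hM]
    exact Finset.inf'_le (q v x) (mem_s.2 hy)

/-- Memoryless determinacy of two-player mean-payoff games on finite graphs. The guarantees hold
for paths that follow the strategy from some time `m` on. -/
theorem exists_memoryless_meanPayoff [Finite V] {E : V → V → Prop} (hE : ∀ v, ∃ u, E v u)
    (M : V → Prop) (w : V → V → ℝ) :
    ∃ (f : V → V) (g : V → ℝ), (∀ x, E x (f x)) ∧
      (∀ (x : ℕ → V) (m : ℕ), (∀ n, m ≤ n → E (x n) (x (n + 1))) →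
        (∀ n, m ≤ n → M (x n) → x (n + 1) = f (x n)) →
        (g (x m) : EReal) ≤ meanPayoff fun i => w (x i) (x (i + 1))) ∧
      (∀ (x : ℕ → V) (m : ℕ), (∀ n, m ≤ n → E (x n) (x (n + 1))) →
        (∀ n, m ≤ n → ¬ M (x n) → x (n + 1) = f (x n)) →
        -(g (x m) : EReal) ≤ meanPayoff fun i => -w (x i) (x (i + 1))) := by
  obtain ⟨B, hB⟩ : ∃ B, ∀ x y, |w x y| ≤ B := by
    obtain ⟨B, hB⟩ := (Set.finite_range fun z : V × V => |w z.1 z.2|).bddAbove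
    exact ⟨B, fun x y => hB ⟨(x, y), rfl⟩⟩
  let lam : ℕ → ℝ := fun k => 1 / ((k : ℝ) + 1)
  have hlam : ∀ k, 0 < lam k ∧ lam k ≤ 1 := fun k =>
    ⟨by positivity, (div_le_one (by positivity)).2 (by linarith [Nat.cast_nonneg (α := ℝ) k])⟩
  have hlim : Filter.Tendsto lam (Filter.hyperfilter ℕ) (nhds 0) :=
    tendsto_one_div_add_atTop_nhds_zero_nat.mono_left Nat.hyperfilter_le_atTop
  choose v f hfE hvB hvf hvM hvN using fun k =>
    exists_discounted_solution hE M hB (hlam k).1 (hlam k).2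
  -- There are finitely many maps `V → V`, so the ultrafilter selects one that is optimal for
  -- arbitrarily small discount factors.
  obtain ⟨f₀, hf₀⟩ := Ultrafilter.eq_pure_of_finite ((Filter.hyperfilter ℕ).map f)
  have hf₀' : ∀ᶠ k in (Filter.hyperfilter ℕ : Filter ℕ), f k = f₀ := by
    have : ({f₀} : Set (V → V)) ∈ (Filter.hyperfilter ℕ).map f := by rw [hf₀]; simp
    exact this
  -- The discounted values stay in a compact box, hence converge along the same ultrafilter.
  obtain ⟨g, -, hg⟩ := (isCompact_univ_pi fun _ : V =>
    isCompact_Icc (a := -B) (b := B)).ultrafilter_le_nhds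
    ((Filter.hyperfilter ℕ).map v) (by
      rw [Filter.le_principal_iff, Ultrafilter.coe_map, Filter.mem_map]
      exact Filter.Eventually.of_forall fun k x _ => abs_le.1 (hvB k x))
  have hv : Filter.Tendsto v (Filter.hyperfilter ℕ) (nhds g) := hg
  refine ⟨f₀, g, ?_, fun x m hx hxf => ?_, fun x m hx hxf => ?_⟩
  · obtain ⟨k, rfl⟩ := hf₀'.exists
    exact hfE k
  · refine le_meanPayoff_of_bellman hlam hlim hv ?_
    filter_upwards [hf₀'] with k hk n hn
    by_cases hM : M (x n)
    · rw [hxf n hn hM, ← hk]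
      exact (hvf k _).le
    · exact hvN k _ _ hM (hx n hn)
  · rw [← EReal.coe_neg]
    -- The minimizer's guarantee is the same lemma with values and rewards negated.
    refine le_meanPayoff_of_bellman (v := fun k => -v k) (g := -g) hlam hlim hv.neg ?_
    filter_upwards [hf₀'] with k hk n hn
    simp only [Pi.neg_apply]
    by_cases hM : M (x n)
    · linarith [hvM k _ _ hM (hx n hn)]
    · rw [hxf n hn hM, ← hk]
      linarith [hvf k (x n)]

end Determinacy

/-! ### Histories, plays and updated profiles -/

section Playpast

variable {V : Type*}

@[simp]
theorem playPast_zero (x : ℕ → V) : playPast x 0 = [] := rfl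

theorem playPast_succ (x : ℕ → V) (n : ℕ) : playPast x (n + 1) = playPast x n ++ [x n] := by
  simp [playPast, List.range_succ]

@[simp]
theorem length_playPast (x : ℕ → V) (n : ℕ) : (playPast x n).length = n := by
  simp [playPast]

theorem playPast_congr {x y : ℕ → V} {n : ℕ} (h : ∀ i < n, x i = y i) :
    playPast x n = playPast y n :=
  List.map_congr_left fun i hi => h i (List.mem_range.1 hi)

end Playpast

namespace MMPGArena

variable {P V : Type*} {A : MMPGArena P V}

namespace Profile

theorem edge_move (σ : A.Profile) (w : List V) (v : V) : A.Edge v (σ.move w v) :=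
  (σ (A.owner v) w ⟨v, rfl⟩).2

theorem historyFrom_fst (σ : A.Profile) (v : V) (n : ℕ) :
    (σ.historyFrom v n).1 = playPast (σ.playFrom v) n := by
  induction n with
  | zero => rfl
  | succ n ih => rw [playPast_succ, ← ih]; rfl

theorem playFrom_succ (σ : A.Profile) (v : V) (n : ℕ) :
    σ.playFrom v (n + 1) = σ.move (playPast (σ.playFrom v) n) (σ.playFrom v n) := by
  rw [← historyFrom_fst]; rfl

theorem play_zero (σ : A.Profile) : σ.play 0 = A.init := rfl

theorem play_succ (σ : A.Profile) (n : ℕ) :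
    σ.play (n + 1) = σ.move (playPast σ.play n) (σ.play n) :=
  σ.playFrom_succ A.init n

theorem isPath_playFrom (σ : A.Profile) (v : V) : A.IsPath (σ.playFrom v) := fun n => by
  rw [playFrom_succ]; exact σ.edge_move _ _

theorem isPath_play (σ : A.Profile) : A.IsPath σ.play := σ.isPath_playFrom _

/-- The play of a profile agrees with every sequence that follows the profile. -/
theorem play_eq_of_forall_lt (σ : A.Profile) {x : ℕ → V} {n : ℕ} (h0 : x 0 = A.init)
    (h : ∀ k < n, x (k + 1) = σ.move (playPast x k) (x k)) : ∀ k ≤ n, σ.play k = x k := by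
  intro k
  induction k using Nat.strong_induction_on with
  | _ k ih =>
    intro hk
    cases k with
    | zero => exact h0.symm
    | succ k =>
      rw [play_succ, h k (by omega), ih k (by omega) (by omega),
        playPast_congr fun i hi => ih i (by omega) (by omega)]

theorem move_congr_strategy {σ τ : A.Profile} {v : V} (h : σ (A.owner v) = τ (A.owner v))
    (w : List V) : σ.move w v = τ.move w v := by
  unfold move; rw [h]

variable [DecidableEq P]

theorem move_update_of_ne (σ : A.Profile) {p : P} (τ : A.Strategy p) (w : List V) {v : V}
    (h : A.owner v ≠ p) : move (Function.update σ p τ) w v = σ.move w v :=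
  move_congr_strategy (Function.update_of_ne h _ _) w

theorem move_update_self (σ : A.Profile) {p : P} (τ : A.Strategy p) (w : List V) {v : V}
    (h : A.owner v = p) : move (Function.update σ p τ) w v = τ w ⟨v, h⟩ := by
  subst h
  simp [move]

end Profile

/-- The strategy that applies a successor function. -/
def strategyOf (m : List V → V → V) (hm : ∀ w v, A.Edge v (m w v)) (p : P) : A.Strategy p :=
  fun w v => ⟨m w v, hm w v⟩

@[simp]
theorem move_strategyOf (m : List V → V → V) (hm : ∀ w v, A.Edge v (m w v)) (w : List V) (v : V) :
    Profile.move (A := A) (strategyOf m hm) w v = m w v := rfl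

/-! ### Values and optimal strategies in the arena -/

section Optimal

variable [Finite V] [DecidableEq P]

/-- Optimal memoryless strategies exist for both sides of the game of `p` against all others, and
their guarantees hold for paths that follow them from some time on. -/
theorem exists_isOptimalMemoryless (A : MMPGArena P V) (p : P) :
    ∃ (f : V → V) (g : V → ℝ), A.IsOptimalMemoryless p f ∧
      (∀ x m, A.IsPath x → (∀ n, m ≤ n → A.owner (x n) = p → x (n + 1) = f (x n)) →
        (g (x m) : EReal) ≤ A.rawPayoff p x) ∧
      (∀ x m, A.IsPath x → (∀ n, m ≤ n → A.owner (x n) ≠ p → x (n + 1) = f (x n)) →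
        A.rawPayoff p x ≤ g (x m)) := by
  obtain ⟨f, g, hf, hmax, hmin⟩ := exists_memoryless_meanPayoff A.exists_edge
    (fun v => A.owner v = p) (fun x y => (A.reward p x y : ℝ))
  have hval : ∀ v, A.value p v = g v := fun v => by
    refine le_antisymm (iSup_le fun τ => ?_) ?_
    · refine (iInf_le _ (strategyOf (fun _ => f) fun _ => hf)).trans ?_
      refine meanPayoff_le_of_neg_le
        (hmin (Profile.playFrom _ v) 0 (fun n _ => Profile.isPath_playFrom _ v n) fun n _ hn => ?_)
      rw [Profile.playFrom_succ, Profile.move_update_of_ne _ _ _ hn, move_strategyOf]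
    · refine le_trans ?_ (le_iSup _ (strategyOf (fun _ => f) (fun _ => hf) p))
      refine le_iInf fun σ =>
        hmax (Profile.playFrom _ v) 0 (fun n _ => Profile.isPath_playFrom _ v n) fun n _ hn => ?_
      rw [Profile.playFrom_succ, Profile.move_update_self _ _ _ hn, strategyOf]
  refine ⟨f, g, ⟨hf, fun x hx h => ?_, fun x hx h => ?_⟩, fun x m hx h => ?_, fun x m hx h => ?_⟩
  · rw [hval]; exact hmax x 0 (fun n _ => hx n) fun n _ => h n
  · rw [hval]; exact hmin x 0 (fun n _ => hx n) fun n _ => h n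
  · exact hmax x m (fun n _ => hx n) h
  · exact meanPayoff_le_of_neg_le (hmin x m (fun n _ => hx n) h)

end Optimal

theorem reward_le_rMax [Finite P] [Finite V] (p : P) {u v : V} (h : A.Edge u v) :
    (A.reward p u v : ℝ) ≤ A.rMax := by
  refine le_csSup (Set.Finite.bddAbove ?_) ⟨p, u, v, h, rfl⟩
  refine (Set.finite_range fun z : P × V × V => (A.reward z.1 z.2.1 z.2.2 : ℝ)).subset ?_
  rintro _ ⟨p, u, v, -, rfl⟩
  exact ⟨(p, u, v), rfl⟩

/-- In an incentive strategy profile, no follower can profit from leaving the play: the value of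
his game at any successor of a vertex of his on the play is at most his payoff. -/
theorem IsISP.le_followerPayoff [DecidableEq P] {σ : A.Profile} {γ : A.IncentiveProfile}
    (h : A.IsISP σ γ) {p : A.Follower} {f : V → V} (hf : ∀ v, A.Edge v (f v)) {g : V → ℝ}
    (hg : ∀ x m, A.IsPath x → (∀ n, m ≤ n → A.owner (x n) = p → x (n + 1) = f (x n)) →
      (g (x m) : EReal) ≤ A.rawPayoff p x)
    {n : ℕ} (hn : A.owner (σ.play n) = p) {u : V} (hu : A.Edge (σ.play n) u) :
    (g u : EReal) ≤ A.followerPayoff γ p σ.play := by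
  classical
  -- The length of the past acts as a clock: copy `σ` before time `n`, move to `u` at time `n`, then
  -- play `f`. The edge test only keeps the choice legal on other histories of length `n`.
  let m : List V → V → V := fun w v =>
    if w.length < n then σ.move w v else if w.length = n ∧ A.Edge v u then u else f v
  have hm : ∀ w v, A.Edge v (m w v) := fun w v => by
    simp only [m]
    split_ifs with h1 h2
    exacts [σ.edge_move w v, h2.2, hf v]
  set ρ : A.Profile := Function.update σ (p : P) (strategyOf m hm p) with hρ
  have hmove : ∀ w v, A.owner v = p → ρ.move w v = m w v := fun w v hv =>
    Profile.move_update_self _ _ _ hv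
  have hprefix : ∀ k ≤ n, ρ.play k = σ.play k :=
    ρ.play_eq_of_forall_lt σ.play_zero fun k hk => by
      rw [σ.play_succ]
      by_cases hv : A.owner (σ.play k) = p
      · rw [hmove _ _ hv]; simp [m, hk]
      · rw [hρ, Profile.move_update_of_ne _ _ _ hv]
  have hnext : ρ.play (n + 1) = u := by
    rw [ρ.play_succ, hprefix n le_rfl, hmove _ _ hn]
    simp [m, hu]
  have hraw : (g u : EReal) ≤ A.rawPayoff p ρ.play := by
    rw [← hnext]
    refine hg _ _ ρ.isPath_play fun k hk hv => ?_
    rw [ρ.play_succ, hmove _ _ hv]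
    simp [m, show ¬ k < n by omega, show k ≠ n by omega]
  refine hraw.trans (le_trans ?_ (h p (strategyOf m hm p)))
  exact le_add_of_nonneg_right (meanPayoff_nonneg fun i => NNReal.coe_nonneg _)

/-! ### The punishing profile and its incentives -/

section Punishment

open Classical in
/-- The incentives that are constant on the play `x`, top up the rewards of the punishing
followers to `r_max + 1`, and are zero otherwise. -/
noncomputable def punishIncentive (σ : A.Profile) (x : ℕ → V) (c : A.Follower → ℝ≥0) :
    A.IncentiveProfile := fun q w v =>
  if ∃ n, w = playPast x n ∧ v = x n then c q
  else if A.IsPunishingMove σ q w v then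
    -- A punishing move has a non-empty past, so the default of `getLastD` is never used. The
    -- truncation is harmless by `reward_le_rMax`.
    (A.rMax + 1 - A.reward q (w.getLastD v) v).toNNReal
  else 0

theorem punishIncentive_playPast (σ : A.Profile) (x : ℕ → V) (c : A.Follower → ℝ≥0)
    (q : A.Follower) (n : ℕ) : punishIncentive σ x c q (playPast x n) (x n) = c q :=
  if_pos ⟨n, rfl, rfl⟩

theorem incentivePayoff_punishIncentive (σ : A.Profile) (x : ℕ → V) (c : A.Follower → ℝ≥0)
    (q : A.Follower) : A.incentivePayoff (punishIncentive σ x c) q x = ((c q : ℝ) : EReal) := by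
  unfold incentivePayoff
  rw [← meanPayoff_const]
  congr 1
  ext i
  rw [punishIncentive, if_pos ⟨i, rfl, rfl⟩]

/-- The successor selected at time `n` in the vertex `v`: follow `x` as long as nobody has
deviated, and punish the last deviator `p` by `f p` otherwise. -/
def punishNext [DecidableEq V] (x : ℕ → V) (f : P → V → V) (d : V → V) :
    Option P → ℕ → V → V
  -- If the history starts in `x 0` and nobody has deviated, then `v = x n`; `d` only makes the
  -- strategy total on other sequences.
  | none, n, v => if v = x n then x (n + 1) else d v
  | some p, _, v => f p v

/-- The last deviator from `punishNext` on the history with last vertex `v` and reversed past. -/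
def deviator [DecidableEq V] (A : MMPGArena P V) (x : ℕ → V) (f : P → V → V) (d : V → V) :
    List V → V → Option P
  | [], _ => none
  | u :: r, v =>
    if v = punishNext x f d (deviator A x f d r u) r.length u then deviator A x f d r u
    else some (A.owner u)

variable [DecidableEq V] {x : ℕ → V} {f : P → V → V} {d : V → V}

/-- The profile that follows `x` and punishes the last deviator `p` by `f p`. -/
def punishProfile (hx : A.IsPath x) (hf : ∀ p v, A.Edge v (f p v)) (hd : ∀ v, A.Edge v (d v)) :
    A.Profile :=
  strategyOf (fun w v => punishNext x f d (deviator A x f d w.reverse v) w.length v) fun w v => by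
    cases deviator A x f d w.reverse v with
    | none =>
      simp only [punishNext]
      split_ifs with h
      exacts [h ▸ hx _, hd v]
    | some p => exact hf p v

variable {hx : A.IsPath x} {hf : ∀ p v, A.Edge v (f p v)} {hd : ∀ v, A.Edge v (d v)}

theorem move_punishProfile (w : List V) (v : V) :
    (punishProfile hx hf hd).move w v =
      punishNext x f d (deviator A x f d w.reverse v) w.length v := rfl

/-- The profile is built from `deviator`, which therefore could not mention it; this recursion
reconnects the two. -/
theorem deviator_append (w : List V) (v u : V) :
    deviator A x f d (w ++ [v]).reverse u =
      if u = (punishProfile hx hf hd).move w v then deviator A x f d w.reverse v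
      else some (A.owner v) := by
  rw [List.reverse_append, List.reverse_singleton, List.singleton_append, deviator,
    List.length_reverse, move_punishProfile]

theorem deviator_playPast (n : ℕ) : deviator A x f d (playPast x n).reverse (x n) = none := by
  induction n with
  | zero => rfl
  | succ n ih => simp [playPast_succ, deviator, ih, punishNext]

theorem move_punishProfile_playPast (n : ℕ) :
    (punishProfile hx hf hd).move (playPast x n) (x n) = x (n + 1) := by
  simp [move_punishProfile, deviator_playPast, punishNext]

theorem play_punishProfile (h0 : x 0 = A.init) : (punishProfile hx hf hd).play = x :=
  funext fun n => Profile.play_eq_of_forall_lt _ h0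
    (fun k _ => (move_punishProfile_playPast k).symm) n le_rfl

/-- The relation and the function are updated alike along a history. In particular the last deviator
is unique. -/
theorem LastDeviator.deviator_eq {w : List V} {v : V} {p : P}
    (h : A.LastDeviator (punishProfile hx hf hd) w v p) :
    deviator A x f d w.reverse v = some p := by
  induction h with
  | now _ _ hu => rw [deviator_append (hx := hx) (hf := hf) (hd := hd), if_neg hu]
  | later _ ih => rw [deviator_append (hx := hx) (hf := hf) (hd := hd), if_pos rfl, ih]

theorem LastDeviator.not_prefix {w : List V} {v : V} {p : P}
    (h : A.LastDeviator (punishProfile hx hf hd) w v p) :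
    ¬ ∃ n, w = playPast x n ∧ v = x n := by
  rintro ⟨n, rfl, rfl⟩
  have := h.deviator_eq
  rw [deviator_playPast] at this
  cases this

/-- After the first deviation of `p` from the punishing profile, `p` stays the last deviator and
everybody else follows `f p`. -/
theorem exists_deviation [DecidableEq P] (h0 : x 0 = A.init) {p : P} (τ : A.Strategy p)
    (hne : Profile.play (Function.update (punishProfile hx hf hd) p τ) ≠ x) :
    ∃ n, A.owner (x n) = p ∧
      A.Edge (x n) (Profile.play (Function.update (punishProfile hx hf hd) p τ) (n + 1)) ∧
      ∀ k, deviator A x f d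
        (playPast (Profile.play (Function.update (punishProfile hx hf hd) p τ)) k).reverse
        (Profile.play (Function.update (punishProfile hx hf hd) p τ) k)
          = if k ≤ n then none else some p := by
  set ρ : A.Profile := Function.update (punishProfile hx hf hd) p τ with hρ
  obtain ⟨N, hN, hmin⟩ : ∃ N, ρ.play N ≠ x N ∧ ∀ k < N, ρ.play k = x k := by
    have h : ∃ N, ρ.play N ≠ x N := by
      by_contra! h
      exact hne (funext h)
    exact ⟨Nat.find h, Nat.find_spec h, fun k hk => not_not.1 (Nat.find_min h hk)⟩
  cases N with
  | zero => exact absurd h0.symm hN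
  | succ n =>
    have hn : ρ.play n = x n := hmin n n.lt_succ_self
    have hpast : ∀ k ≤ n, playPast ρ.play k = playPast x k := fun k hk =>
      playPast_congr fun i hi => hmin i (by omega)
    -- Any other owner would still follow the profile, and so stay on `x`.
    have howner : A.owner (x n) = p := by
      by_contra hv
      refine hN ?_
      rw [ρ.play_succ, hn, hpast n le_rfl, hρ, Profile.move_update_of_ne _ _ _ hv,
        move_punishProfile_playPast]
    refine ⟨n, howner, hn ▸ ρ.isPath_play n, fun k => ?_⟩
    induction k with
    | zero => simp [deviator]
    | succ k ih =>
      rcases lt_trichotomy k n with hk | rfl | hk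
      · rw [hpast _ hk, hmin _ (by omega), deviator_playPast, if_pos (by omega)]
      · rw [playPast_succ, deviator_append (hx := hx) (hf := hf) (hd := hd), if_neg,
          if_neg (by omega), hn, howner]
        rwa [hn, hpast k le_rfl, move_punishProfile_playPast]
      · rw [if_neg (by omega)] at ih ⊢
        rw [playPast_succ, deviator_append (hx := hx) (hf := hf) (hd := hd), ih]
        split_ifs with hmv
        · rfl
        -- After the deviation, a mismatch can occur only at a vertex of `p`, which makes `p` the
        -- last deviator again.
        · by_contra hv
          refine hmv ?_
          rw [ρ.play_succ, hρ, Profile.move_update_of_ne _ _ _ fun e => hv (congrArg some e)]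

/-! ### The punishing profile as PSP and as ISP -/

variable [DecidableEq P]

theorem isPSP_punishProfile [Finite P] [Finite V] (h0 : x 0 = A.init)
    (hopt : ∀ p, A.IsOptimalMemoryless p (f p)) (c : A.Follower → ℝ≥0) :
    A.IsPSP (punishProfile hx hf hd) (punishIncentive (punishProfile hx hf hd) x c) where
  const_on_play q m n := by
    rw [play_punishProfile h0, punishIncentive_playPast, punishIncentive_playPast]
  punish := ⟨f, hopt, fun w v p h => by
    rw [move_punishProfile, h.deviator_eq]; rfl⟩
  reward_punisher q w v p h hv hq := by
    rw [punishIncentive, if_neg (LastDeviator.later h).not_prefix,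
      if_pos ⟨w, v, p, h, hv, hq, rfl, rfl⟩]
    have := reward_le_rMax (A := A) q ((punishProfile hx hf hd).edge_move w v)
    rw [List.getLastD_concat, Real.coe_toNNReal _ (by linarith)]
    ring
  zero_otherwise q w v h hnot := by
    rw [IsDeviating, play_punishProfile h0] at h
    rw [punishIncentive, if_neg h.2, if_neg hnot]

theorem isISP_punishProfile {c : A.Follower → ℝ≥0} (h0 : x 0 = A.init) {g : P → V → ℝ}
    (hmin : ∀ p y m, A.IsPath y → (∀ n, m ≤ n → A.owner (y n) ≠ p → y (n + 1) = f p (y n)) →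
      A.rawPayoff p y ≤ g p (y m))
    (hle : ∀ (p : A.Follower) n u, A.owner (x n) = p → A.Edge (x n) u →
      (g p u : EReal) ≤ A.followerPayoff (punishIncentive (punishProfile hx hf hd) x c) p x) :
    A.IsISP (punishProfile hx hf hd) (punishIncentive (punishProfile hx hf hd) x c) := by
  intro p τ
  rw [play_punishProfile h0]
  by_cases hne : Profile.play (Function.update (punishProfile hx hf hd) (p : P) τ) = x
  · rw [hne]
  obtain ⟨n, howner, hedge, hdev⟩ := exists_deviation h0 τ hne
  refine le_trans ?_ (hle p n _ howner hedge)
  set ρ : A.Profile := Function.update (punishProfile hx hf hd) (p : P) τ with hρ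
  -- Top-ups go only to players other than the last deviator, and the finitely many incentives paid
  -- before the deviation vanish in the average.
  have hzero : A.incentivePayoff (punishIncentive (punishProfile hx hf hd) x c) p ρ.play = 0 := by
    refine meanPayoff_eq_zero_of_eventually_zero (m := n + 1) fun k hk => ?_
    rw [NNReal.coe_eq_zero, punishIncentive, if_neg, if_neg]
    · rintro ⟨w, v, q, hq, hv, hpq, hw, -⟩
      obtain ⟨j, rfl⟩ : ∃ j, k = j + 1 := ⟨k - 1, by omega⟩
      rw [playPast_succ] at hw
      obtain ⟨rfl, hv'⟩ := List.append_inj' hw rfl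
      obtain rfl : ρ.play j = v := by simpa using hv'
      have := hq.deviator_eq
      rw [hdev] at this
      -- Incentives at time `j + 1` depend on the deviator at time `j`: for `j = n` there is none
      -- yet, later it is `p` himself.
      split_ifs at this
      exact hpq (Option.some.inj this)
    · rintro ⟨j, hw, hv⟩
      have := hdev k
      rw [hw, hv, deviator_playPast, if_neg (by omega)] at this
      cases this
  rw [followerPayoff, hzero, add_zero]
  refine hmin p _ _ ρ.isPath_play fun k hk hv => ?_
  rw [ρ.play_succ, hρ, Profile.move_update_of_ne _ _ _ hv, ← hρ, move_punishProfile, hdev,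
    if_neg (by omega), punishNext]

end Punishment

end MMPGArena

/-! ### The theorem -/

theorem mainTheorem4 {P V : Type*} [Fintype P] [DecidableEq P] [Finite V]
    (A : MMPGArena P V) (σ : A.Profile) (γ : A.IncentiveProfile)
    (hISP : A.IsISP σ γ)
    (hfin : ∀ p : A.Follower, A.incentivePayoff γ p σ.play ≠ ⊤) :
    ∃ (σ' : A.Profile) (γ' : A.IncentiveProfile),
      A.IsPSP σ' γ' ∧ A.IsISP σ' γ' ∧
      σ'.play = σ.play ∧
      (∀ p : A.Follower, A.followerPayoff γ' p σ'.play = A.followerPayoff γ p σ.play) ∧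
      A.leaderPayoff γ' σ'.play = A.leaderPayoff γ σ.play := by
  classical
  choose f g hopt hmax hmin using fun p => A.exists_isOptimalMemoryless p
  choose d hd using A.exists_edge
  let σ' : A.Profile := MMPGArena.punishProfile σ.isPath_play (fun p => (hopt p).1) hd
  have hnonneg : ∀ p : A.Follower, 0 ≤ A.incentivePayoff γ p σ.play := fun p =>
    meanPayoff_nonneg fun i => NNReal.coe_nonneg _
  -- By `hfin` and non-negativity the limit average is a real number, so `toReal` and `toNNReal`
  -- lose nothing.
  let c : A.Follower → ℝ≥0 := fun p => (A.incentivePayoff γ p σ.play).toReal.toNNReal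
  let γ' : A.IncentiveProfile := MMPGArena.punishIncentive σ' σ.play c
  have hinc : ∀ p, A.incentivePayoff γ' p σ.play = A.incentivePayoff γ p σ.play := fun p => by
    rw [MMPGArena.incentivePayoff_punishIncentive,
      Real.coe_toNNReal _ (EReal.toReal_nonneg (hnonneg p)),
      EReal.coe_toReal (hfin p) (ne_bot_of_le_ne_bot EReal.zero_ne_bot (hnonneg p))]
  have hplay : σ'.play = σ.play := MMPGArena.play_punishProfile σ.play_zero
  have hfol : ∀ p, A.followerPayoff γ' p σ.play = A.followerPayoff γ p σ.play := fun p => by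
    rw [MMPGArena.followerPayoff, MMPGArena.followerPayoff, hinc]
  refine ⟨σ', γ', MMPGArena.isPSP_punishProfile σ.play_zero hopt c,
    MMPGArena.isISP_punishProfile σ.play_zero hmin fun p n u hn hu => ?_, hplay,
    fun p => hplay ▸ hfol p, ?_⟩
  · exact (hISP.le_followerPayoff (hopt p).1 (hmax p) hn hu).trans_eq (hfol p).symm
  · rw [hplay, MMPGArena.leaderPayoff, MMPGArena.leaderPayoff]
    simp only [hinc]
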